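/- Conventions. Strings are finite binary strings, $|y|$ is the length of $y$, and objects (strings, natural numbers, finite lists, pairs of programs) are identified with natural numbers by a standard computable coding. Let $U$ be an optimal machine for plain conditional Kolmogorov complexity: a partial computable function of a binary program and a condition such that for every partial computable $V$ there is a constant $e$ with the property that whenever $V(p,z)=a$ there is a program $q$ with $|q|\le|p|+e$ and $U(q,z)=a$. Put $C(a\mid z)=\min\{|p| : U(p,z)=a\}$, and let $C(a)$ be $C(a\mid z)$ for a trivial condition $z$. For an integer-valued function $h$ on $\{0,1,\dots,k\}$, $C(h)$ is the complexity of the list $h(0),\dots,h(k)$. A one-way protocol is a pair of programs $P=(P_A,P_B)$: on input $y$ Bob's program $P_B$ computes a binary string $m$, which is sent to Alice as a whole (the messages need not form a prefix-free set), and on input $x$ and $m$ Alice's program $P_A$ computes her output. For a string $y$ of length $n$ and a natural number $\alpha$, $TCC_I^{\alpha}(y)$ is the minimum of the length of the message sent on $y$, over all one-way protocols $P$ with $C(P\mid n)\le\alpha$ that on every pair $(x',y')$ of strings of length $n$ terminate with Alice outputting $y'$ (it is $\infty$ if there is no such protocol). Let $\ell(n)=\lfloor\log_2 n\rfloor+1$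 for $n\ge1$ and $\ell(0)=1$. Theorem. For every optimal $U$ and every constant $c$ there is a constant $d$ such that the following holds for all natural numbers $k\le n$. Let $h:\{0,1,\dots,k\}\to\mathbb{N}$ be a strictly decreasing function with $h(0)=n$, $h(k)=0$, $C(h)\le c\,\ell(n)$ and $h(\alpha)+\alpha\ge k$ for all $\alpha\in\{0,\dots,k\}$. Then there is a string $y$ of length $n$ with $|C(y)-k|\le d\,\ell(n)$ such that \begin{align*} TCC_I^{\alpha+d\,\ell(n)}(y)&\le h(\alpha) &&\text{for all integers } 0\le\alpha\le k,\\ h(\alpha+d\,\ell(n))&\le TCC_I^{\alpha}(y) &&\text{for all integers } \alpha\ge0 \text{ with } \alpha+d\,\ell(n)\le k. \end{align*} -/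

import Mathlib

/-- Finite binary strings. -/
abbrev BitString := List Bool

/-- A description mode: it takes a binary program and the code of a condition, and it returns the
code of an object (or diverges). Objects and conditions are coded by natural numbers through the
computable coding `Encodable.encode`. -/
abbrev DescriptionMode := BitString → ℕ →. ℕ

/-- An optimal (reference universal) machine for plain conditional Kolmogorov complexity: it is
partial computable, and it simulates every other partial computable description mode at the price
of a constant number of additional program bits. -/
structure IsOptimalMachine (U : DescriptionMode) : Prop where
  partrec : Partrec₂ U
  optimal : ∀ V : DescriptionMode, Partrec₂ V →
    ∃ c : ℕ, ∀ (p : BitString) (z a : ℕ), a ∈ V p z →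
      ∃ q : BitString, q.length ≤ p.length + c ∧ a ∈ U q z

/-- Plain conditional Kolmogorov complexity `C(a | b)`: the least length of a program from which
`U`, given `b`, computes `a`. -/
noncomputable def condC (U : DescriptionMode) {A B : Type} [Primcodable A] [Primcodable B]
    (a : A) (b : B) : ℕ∞ :=
  ⨅ (p : BitString) (_ : Encodable.encode a ∈ U p (Encodable.encode b)), (p.length : ℕ∞)

/-- Plain Kolmogorov complexity `C(a)`, the condition being trivial. -/
noncomputable def plainC (U : DescriptionMode) {A : Type} [Primcodable A] (a : A) : ℕ∞ :=
  condC U a ()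

/-- A one-way protocol `(P_A, P_B)`: Bob's program turns his input into the message that he sends,
Alice's program turns her input and the whole message into her output. -/
structure OneWayProtocol where
  alice : Nat.Partrec.Code
  bob : Nat.Partrec.Code

namespace OneWayProtocol

/-- On input `y` Bob's program halts and sends the message `m`. -/
def Sends (P : OneWayProtocol) (y m : BitString) : Prop :=
  Encodable.encode m ∈ P.bob.eval (Encodable.encode y)

/-- On input `x` and message `m` Alice's program halts with output `z`. -/
def Outputs (P : OneWayProtocol) (x m z : BitString) : Prop :=
  Encodable.encode z ∈ P.alice.eval (Encodable.encode (x, m))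

/-- `P` is total on the strings of length `n` and computes `f` correctly on all of them. -/
def TotallyComputes (P : OneWayProtocol) (n : ℕ) (f : BitString → BitString → BitString) : Prop :=
  ∀ x y : BitString, x.length = n → y.length = n →
    ∃ m : BitString, P.Sends y m ∧ P.Outputs x m (f x y)

/-- The complexity `C(P | n)` of a protocol for strings of length `n`. -/
noncomputable def complexity (U : DescriptionMode) (P : OneWayProtocol) (n : ℕ) : ℕ∞ :=
  condC U (P.alice, P.bob) n

end OneWayProtocol

/-- One-way total communication complexity `TCC_f^α(y)`: the least number of bits that Bob sends on
input `y`, over all one-way protocols of complexity at most `α` that are total on the strings of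
length `|y|` and always compute `f` correctly; it is `⊤` if there is no such protocol. -/
noncomputable def TCC (U : DescriptionMode) (f : BitString → BitString → BitString)
    (α : ℕ) (y : BitString) : ℕ∞ :=
  ⨅ (P : OneWayProtocol) (m : BitString) (_ : P.TotallyComputes y.length f)
    (_ : P.complexity U y.length ≤ (α : ℕ∞)) (_ : P.Sends y m), (m.length : ℕ∞)

/-- The identity function `I(x, y) = y`. -/
def identityFn : BitString → BitString → BitString := fun _ y => y

/-- The finite object that a function on the integer interval `[0, k]` is: the list of its
values `h(0), …, h(k)`. -/
def valueTable (h : ℕ → ℕ) (k : ℕ) : List ℕ := (List.range (k + 1)).map h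

/-- The length of the binary notation of `n`, the unit of logarithmic precision;
it is `1` for `n = 0`. -/
def logLen (n : ℕ) : ℕ := Nat.log 2 n + 1

/-! Run all short programs `p` with condition `n`. Once `p` is seen to give a protocol whose
messages let Alice recover every string of length `n`, strike out the strings whose messages are
shorter than `h (|p| + δ)`, where `δ` is of order `log n`. Distinct strings have distinct messages,
so `p` strikes out at most `2 ^ h (|p| + δ)` of them. As `h` is strictly decreasing, `h j + j` does
not increase, so the programs of one length strike out at most `2 ^ (n - δ)` strings. There are
fewer than `2 ^ δ` lengths, so something survives (`survivors_ne_nil`). Let `y` be the first final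
survivor in a fixed order; the lower bound on its TCC is built in (`le_TCC_of_mem_survivors`).

For the upper bound at scale `i`, count each active program with weight `2 ^ h (|p| + δ)` truncated
at `2 ^ h i`. The total is below `2 ^ (i + h i)` (`weight_lt`), so the final weight in whole units
of `2 ^ h i` is an `i`-bit number. Knowing it, one can wait for the first moment when it is reached.
After that moment the weight grows by less than one unit, so fewer than `2 ^ h i` strings are still
to be struck out (`card_survivors_sdiff_lt`), and `y` is among the first `2 ^ h i` survivors of that
moment. A protocol with this list built in sends the place of `y` in `h i` bits, and strings outside
the list verbatim.

At scale `k` the list shrinks to `y` alone, so `C(y)` is at most `k + O(log n)`. Conversely, a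
program for `y` gives a protocol of nearly the same complexity with an empty message on `y`; the
lower bound forbids this well below `k`, where `h` is positive. -/

open Encodable
open Nat.Partrec (Code)

/-! ### Enumeration of strings and self-delimiting codes -/

/-- All bit strings of length `n`. -/
def bitStrings : ℕ → List BitString
  | 0 => [[]]
  | n + 1 => (bitStrings n).flatMap fun s => [false :: s, true :: s]

theorem mem_bitStrings {n : ℕ} {s : BitString} : s ∈ bitStrings n ↔ s.length = n := by
  induction n generalizing s with
  | zero => simp [bitStrings]
  | succ n ih =>
    cases s with
    | nil => simp [bitStrings]
    | cons b s => cases b <;> simp [bitStrings, ih]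

theorem length_bitStrings (n : ℕ) : (bitStrings n).length = 2 ^ n := by
  induction n with
  | zero => simp [bitStrings]
  | succ n ih => simp [bitStrings, List.length_flatMap, ih, pow_succ]

theorem nodup_bitStrings (n : ℕ) : (bitStrings n).Nodup := by
  induction n with
  | zero => simp [bitStrings]
  | succ n ih =>
    refine List.nodup_flatMap.2 ⟨by simp, ih.imp fun {a b} hab => ?_⟩
    simp [Function.onFun, Ne.symm hab]

theorem bitStrings_ne_nil (n : ℕ) : bitStrings n ≠ [] := by
  intro h
  have := length_bitStrings n
  have := Nat.two_pow_pos n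
  simp_all

theorem length_headI_bitStrings (n : ℕ) : (bitStrings n).headI.length = n := by
  rw [← mem_bitStrings]
  cases h : bitStrings n with
  | nil => exact absurd h (bitStrings_ne_nil n)
  | cons a l => simp

theorem primrec_bitStrings : Primrec bitStrings := by
  refine (Primrec.nat_rec₁ (f := fun _ (l : List BitString) =>
    l.flatMap fun s => [false :: s, true :: s]) [[]] ?_).of_eq fun n => ?_
  · refine Primrec.list_flatMap Primrec.snd ?_
    have h (b : Bool) : Primrec₂ fun (_ : ℕ × List BitString) (s : BitString) => b :: s :=
      Primrec.list_cons.comp (Primrec.const b) Primrec.snd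
    exact Primrec.list_cons.comp (h false) (Primrec.list_cons.comp (h true) (Primrec.const []))
  · induction n with
    | zero => rfl
    | succ n ih => simp only [bitStrings, ← ih]

/-- Strings shorter than `l` number at most `2 ^ l`. -/
theorem card_le_of_length_lt (S : Finset BitString) (l : ℕ) (hS : ∀ s ∈ S, s.length < l) :
    S.card ≤ 2 ^ l := by
  have h : S ⊆ (Finset.range l).biUnion fun j => (bitStrings j).toFinset := by
    intro s hs
    simp [mem_bitStrings, hS s hs]
  calc S.card ≤ _ := Finset.card_le_card h
    _ ≤ ∑ j ∈ Finset.range l, (bitStrings j).toFinset.card := Finset.card_biUnion_le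
    _ ≤ ∑ j ∈ Finset.range l, 2 ^ j :=
        Finset.sum_le_sum fun j _ => (List.toFinset_card_le _).trans (length_bitStrings j).le
    _ ≤ 2 ^ l := (Nat.geomSum_lt le_rfl (by simp)).le

theorem primrec_two_pow : Primrec fun n : ℕ => 2 ^ n :=
  (Primrec₂.unpaired'.1 Nat.Primrec.pow).comp (Primrec.const 2) Primrec.id

/-- The self-delimiting form of a string. -/
def block (s : BitString) : BitString := List.replicate s.length true ++ false :: s

/-- Cuts off a leading self-delimited string. -/
def splitBlock (p : BitString) : BitString × BitString :=
  ((p.drop (p.idxOf false + 1)).take (p.idxOf false),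
    (p.drop (p.idxOf false + 1)).drop (p.idxOf false))

theorem length_block (s : BitString) : (block s).length = 2 * s.length + 1 := by
  simp [block]; omega

theorem splitBlock_block_append (s r : BitString) : splitBlock (block s ++ r) = (s, r) := by
  have h : (block s ++ r).idxOf false = s.length := by
    rw [block, List.append_assoc, List.idxOf_append_of_notMem (by simp)]
    simp
  have h2 : (block s ++ r).drop (s.length + 1) = s ++ r := by
    simp [block, List.drop_append]
  simp [splitBlock, h, h2]

theorem primrec_splitBlock : Primrec splitBlock := by
  have h : Primrec fun p : BitString => p.idxOf false :=
    Primrec.list_idxOf.comp (Primrec.const false) Primrec.id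
  have h2 : Primrec fun p : BitString => p.drop (p.idxOf false + 1) :=
    Primrec.list_drop.comp (Primrec.succ.comp h) Primrec.id
  exact (Primrec.list_take.comp h h2).pair (Primrec.list_drop.comp h h2)

theorem primrec_idxOf_bitString :
    Primrec₂ fun (x : BitString) (l : List BitString) => l.idxOf x := by
  refine Primrec.list_idxOf.of_eq fun x l => ?_
  congr 1
  exact lawful_beq_subsingleton _ _

/-- The number that a string denotes: its stringRank among the strings of the same length. -/
def stringRank (s : BitString) : ℕ := (bitStrings s.length).idxOf s

theorem primrec_stringRank : Primrec stringRank :=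
  primrec_idxOf_bitString.comp Primrec.id (primrec_bitStrings.comp Primrec.list_length)

theorem exists_stringRank_eq {j q : ℕ} (h : q < 2 ^ j) :
    ∃ s : BitString, s.length = j ∧ stringRank s = q := by
  rw [← length_bitStrings] at h
  have hl : ((bitStrings j)[q]).length = j := mem_bitStrings.1 (List.getElem_mem h)
  refine ⟨(bitStrings j)[q], hl, ?_⟩
  rw [stringRank, hl]
  exact (nodup_bitStrings j).idxOf_getElem q h

/-! ### Protocols given by tables -/

/-- Replaces `x` by the entry of `B` at the place where `x` stands in `A`, if there is one. -/
def recode (A B : List BitString) (x : BitString) : BitString := (B[A.idxOf x]?).getD x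

/-- A string outside `A` passes unchanged, so it must not be mistaken for a code word in `B`; this
is what `hy` excludes. -/
theorem recode_recode {A B : List BitString} (hl : A.length = B.length) (hB : B.Nodup)
    {y : BitString} (hy : y ∈ B → y ∈ A) : recode B A (recode A B y) = y := by
  by_cases h : y ∈ A
  · have h1 : A.idxOf y < A.length := List.idxOf_lt_length_of_mem h
    have h2 : A.idxOf y < B.length := hl ▸ h1
    have : recode A B y = B[A.idxOf y] := by simp [recode, h2]
    rw [this, recode, hB.idxOf_getElem _ h2]
    simp [h1]
  · have hB' : y ∉ B := fun h' => h (hy h')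
    have : recode A B y = y := by
      rw [recode, List.idxOf_eq_length h, hl]; simp
    rw [this, recode, List.idxOf_eq_length hB', hl.symm]; simp

theorem primrec_recode :
    Primrec fun a : (List BitString × List BitString) × BitString => recode a.1.1 a.1.2 a.2 :=
  Primrec.option_getD.comp
    (Primrec.list_getElem?.comp (Primrec.snd.comp Primrec.fst)
      (primrec_idxOf_bitString.comp Primrec.snd (Primrec.fst.comp Primrec.fst)))
    Primrec.snd

theorem Computable.exists_code {α σ : Type*} [Primcodable α] [Primcodable σ] {f : α → σ}
    (hf : Computable f) : ∃ c : Code, ∀ a, c.eval (encode a) = Part.some (encode (f a)) := by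
  obtain ⟨c, hc⟩ := Code.exists_code.1 hf
  refine ⟨c, fun a => ?_⟩
  rw [hc]; simp

theorem Partrec₂.exists_code {U : DescriptionMode} (hU : Partrec₂ U) :
    ∃ c : Code, ∀ p z, c.eval (encode (p, z)) = U p z := by
  obtain ⟨c, hc⟩ := Code.exists_code.1 hU
  refine ⟨c, fun p z => ?_⟩
  rw [hc]; simp [Part.map_id']

/-- Tables of strings give one-way protocols, effectively: Bob recodes his input by the table,
Alice recodes the message back. -/
theorem exists_tableProtocol : ∃ F : List BitString → List BitString → Code × Code, Primrec₂ F ∧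
    ∀ A B x y, let P : OneWayProtocol := ⟨(F A B).1, (F A B).2⟩
      P.Sends y (recode A B y) ∧ P.Outputs x y (recode B A y) := by
  obtain ⟨cb, hb⟩ := primrec_recode.to_comp.exists_code
  obtain ⟨ca, ha⟩ := (primrec_recode.comp (Primrec.fst.pair
    (Primrec.snd.comp Primrec.snd)) : Primrec fun a : (List BitString × List BitString) ×
      (BitString × BitString) => recode a.1.1 a.1.2 a.2.2).to_comp.exists_code
  refine ⟨fun A B => (ca.curry (encode (B, A)), cb.curry (encode (A, B))), ?_, ?_⟩
  · exact (Code.primrec₂_curry.comp (Primrec.const ca)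
        (Primrec.encode.comp (Primrec.snd.pair Primrec.fst))).pair
      (Code.primrec₂_curry.comp (Primrec.const cb)
        (Primrec.encode.comp (Primrec.fst.pair Primrec.snd)))
  · intro A B x y
    have hb' := hb ((A, B), y)
    have ha' := ha ((B, A), (x, y))
    rw [encode_prod_val] at hb' ha'
    constructor
    · simp only [OneWayProtocol.Sends, Code.eval_curry]
      rw [hb']; simp
    · simp only [OneWayProtocol.Outputs, Code.eval_curry]
      rw [ha']; simp

/-! ### Step-bounded simulation of protocols -/

/-- A description of length at most `m` exists as soon as the complexity is at most `m`. -/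
theorem exists_program_of_condC_le {U : DescriptionMode} {A B : Type} [Primcodable A]
    [Primcodable B] {a : A} {b : B} {m : ℕ} (h : condC U a b ≤ m) :
    ∃ p : BitString, p.length ≤ m ∧ encode a ∈ U p (encode b) := by
  have h1 : condC U a b < ((m + 1 : ℕ) : ℕ∞) :=
    lt_of_le_of_lt h (by exact_mod_cast Nat.lt_succ_self m)
  simp only [condC, iInf_lt_iff] at h1
  obtain ⟨p, hp, hl⟩ := h1
  exact ⟨p, Nat.lt_succ_iff.1 (by exact_mod_cast hl), hp⟩

theorem condC_le_of_mem {U : DescriptionMode} {A B : Type} [Primcodable A]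
    [Primcodable B] {a : A} {b : B} {p : BitString} (h : encode a ∈ U p (encode b)) :
    condC U a b ≤ p.length :=
  iInf₂_le p h

/-- The message that Bob sends on `y` in the protocol described by `p` (through the machine with
code `c` and with condition `n`), provided that within `t` steps the protocol is found and Alice,
on a fixed input, restores `y`. -/
def messageAt (c : Code) (n t : ℕ) (p y : BitString) : Option BitString :=
  (c.evaln t (encode (p, n))).bind fun e =>
    (decode₂ (Code × Code) e).bind fun P =>
      (P.2.evaln t (encode y)).bind fun r =>
        (decode₂ BitString r).bind fun m =>
          (P.1.evaln t (encode ((bitStrings n).headI, m))).bind fun w =>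
            if w = encode y then some m else none

theorem messageAt_eq_some {c : Code} {n t : ℕ} {p y m : BitString} :
    messageAt c n t p y = some m ↔ ∃ P : Code × Code, encode P ∈ c.evaln t (encode (p, n)) ∧
      encode m ∈ P.2.evaln t (encode y) ∧
      encode y ∈ P.1.evaln t (encode ((bitStrings n).headI, m)) := by
  simp only [messageAt, Option.bind_eq_some_iff, decode₂_eq_some, Option.mem_def]
  constructor
  · rintro ⟨e, he, P, rfl, r, hr, m', rfl, w, hw, h⟩
    split_ifs at h with hwy
    cases h
    exact ⟨P, he, hr, hwy ▸ hw⟩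
  · rintro ⟨P, h1, h2, h3⟩
    exact ⟨_, h1, P, rfl, _, h2, m, rfl, _, h3, by simp⟩

theorem messageAt_mono {c : Code} {n t t' : ℕ} (h : t ≤ t') {p y m : BitString}
    (hm : messageAt c n t p y = some m) : messageAt c n t' p y = some m := by
  rw [messageAt_eq_some] at hm ⊢
  obtain ⟨P, h1, h2, h3⟩ := hm
  exact ⟨P, Code.evaln_mono h h1, Code.evaln_mono h h2, Code.evaln_mono h h3⟩

/-- Alice restores the string from the message on one fixed input, and this injectivity is all that
the counting needs. A program that passes this test but fails on other inputs of Alice does no harm: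
it is counted like the rest. -/
theorem messageAt_injective {c : Code} {n t : ℕ} {p y y' m : BitString}
    (h : messageAt c n t p y = some m) (h' : messageAt c n t p y' = some m) : y = y' := by
  rw [messageAt_eq_some] at h h'
  obtain ⟨P, h1, h2, h3⟩ := h
  obtain ⟨P', h1', h2', h3'⟩ := h'
  have hP : P = P' := encode_injective (Option.mem_unique h1 h1')
  subst hP
  exact encode_injective (Option.mem_unique h3 h3')

theorem primrec_messageAt (c : Code) : Primrec fun a : (ℕ × ℕ) × BitString × BitString =>
    messageAt c a.1.1 a.1.2 a.2.1 a.2.2 := by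
  have ev {α : Type} [Primcodable α] {f : α → ℕ} {g : α → Code} {h : α → ℕ} (hf : Primrec f)
      (hg : Primrec g) (hh : Primrec h) : Primrec fun a => (g a).evaln (f a) (h a) :=
    Code.primrec_evaln.comp ((hf.pair hg).pair hh)
  refine Primrec.option_bind (ev (Primrec.snd.comp Primrec.fst) (Primrec.const c)
    (Primrec.encode.comp ((Primrec.fst.comp Primrec.snd).pair (Primrec.fst.comp Primrec.fst)))) ?_
  refine Primrec.option_bind (Primrec.decode₂.comp Primrec.snd) ?_
  refine Primrec.option_bind (ev (Primrec.snd.comp (Primrec.fst.comp (Primrec.fst.comp Primrec.fst)))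
    (Primrec.snd.comp Primrec.snd) (Primrec.encode.comp
      (Primrec.snd.comp (Primrec.snd.comp (Primrec.fst.comp Primrec.fst))))) ?_
  refine Primrec.option_bind (Primrec.decode₂.comp Primrec.snd) ?_
  refine Primrec.option_bind (ev (Primrec.snd.comp (Primrec.fst.comp (Primrec.fst.comp
      (Primrec.fst.comp (Primrec.fst.comp Primrec.fst)))))
    (Primrec.fst.comp (Primrec.snd.comp (Primrec.fst.comp Primrec.fst)))
    (Primrec.encode.comp ((Primrec.list_headI.comp (primrec_bitStrings.comp (Primrec.fst.comp
      (Primrec.fst.comp (Primrec.fst.comp (Primrec.fst.comp (Primrec.fst.comp Primrec.fst))))))).pair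
        Primrec.snd))) ?_
  exact Primrec.ite (Primrec.eq.comp Primrec.snd (Primrec.encode.comp (Primrec.snd.comp
    (Primrec.snd.comp (Primrec.fst.comp (Primrec.fst.comp (Primrec.fst.comp (Primrec.fst.comp
      Primrec.fst)))))))) (Primrec.option_some.comp (Primrec.snd.comp Primrec.fst))
    (Primrec.const none)

/-- The protocol described by `p` is seen within `t` steps to be total and correct. -/
def IsActive (c : Code) (n t : ℕ) (p : BitString) : Prop :=
  ∀ y ∈ bitStrings n, (messageAt c n t p y).isSome

instance (c : Code) (n t : ℕ) (p : BitString) : Decidable (IsActive c n t p) := by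
  unfold IsActive; infer_instance

theorem IsActive.mono {c : Code} {n t t' : ℕ} (h : t ≤ t') {p : BitString}
    (hp : IsActive c n t p) : IsActive c n t' p := fun y hy => by
  obtain ⟨m, hm⟩ := Option.isSome_iff_exists.1 (hp y hy)
  simp [messageAt_mono h hm]

/-! ### Active programs, struck-out strings and weights -/

/-- The programs `p` for which `p.length + δ` is an argument of the tabulated function. -/
def programs (h : List ℕ) (δ : ℕ) : List BitString :=
  (List.range (h.length - δ)).flatMap bitStrings

theorem mem_programs {h : List ℕ} {δ : ℕ} {p : BitString} :
    p ∈ programs h δ ↔ p.length + δ < h.length := by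
  simp [programs, mem_bitStrings]; omega

theorem nodup_programs (h : List ℕ) (δ : ℕ) : (programs h δ).Nodup := by
  refine List.nodup_flatMap.2 ⟨fun j _ => nodup_bitStrings j,
    List.nodup_range.imp fun {a b} hab => ?_⟩
  intro s hs hs'
  rw [mem_bitStrings] at hs hs'
  exact hab (hs.symm.trans hs')

/-- The programs that describe a total protocol within `t` steps. -/
def activePrograms (c : Code) (h : List ℕ) (δ t : ℕ) : List BitString :=
  (programs h δ).filter fun p => IsActive c (h.getD 0 0) t p

/-- Some active program gives `y` a message shorter than the tabulated function allows. -/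
def IsBad (c : Code) (h : List ℕ) (δ t : ℕ) (y : BitString) : Prop :=
  ∃ p ∈ activePrograms c h δ t,
    ((messageAt c (h.getD 0 0) t p y).getD []).length < h.getD (p.length + δ) 0

instance (c : Code) (h : List ℕ) (δ t : ℕ) (y : BitString) : Decidable (IsBad c h δ t y) := by
  unfold IsBad; infer_instance

/-- The strings that are not bad after `t` steps. -/
def survivors (c : Code) (h : List ℕ) (δ t : ℕ) : List BitString :=
  (bitStrings (h.getD 0 0)).filter fun y => ¬ IsBad c h δ t y

/-- The total weight of the active programs, at scale `i`. -/
def weight (c : Code) (h : List ℕ) (δ i t : ℕ) : ℕ :=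
  ((activePrograms c h δ t).map fun p => 2 ^ min (h.getD (p.length + δ) 0) (h.getD i 0)).sum

theorem primrecPred_isActive (c : Code) :
    PrimrecPred fun a : (ℕ × ℕ) × BitString => IsActive c a.1.1 a.1.2 a.2 := by
  have h : PrimrecRel fun (y : BitString) (a : (ℕ × ℕ) × BitString) =>
      ((messageAt c a.1.1 a.1.2 a.2 y).isSome = true) := by
    refine PrimrecRel.comp Primrec.eq (f := fun a : BitString × (ℕ × ℕ) × BitString =>
      (messageAt c a.2.1.1 a.2.1.2 a.2.2 a.1).isSome) ?_ (Primrec.const true)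
    exact Primrec.option_isSome.comp ((primrec_messageAt c).comp
      ((Primrec.fst.comp Primrec.snd).pair ((Primrec.snd.comp Primrec.snd).pair Primrec.fst)))
  exact h.forall_mem_list.comp (primrec_bitStrings.comp (Primrec.fst.comp Primrec.fst)) Primrec.id

theorem primrec_activePrograms (c : Code) : Primrec fun a : (List ℕ × ℕ) × ℕ =>
    activePrograms c a.1.1 a.1.2 a.2 := by
  have hR : PrimrecRel fun (p : BitString) (a : (List ℕ × ℕ) × ℕ) =>
      IsActive c (a.1.1.getD 0 0) a.2 p :=
    (primrecPred_isActive c).comp ((((Primrec.list_getD 0).comp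
      (Primrec.fst.comp (Primrec.fst.comp Primrec.snd)) (Primrec.const 0)).pair
        (Primrec.snd.comp Primrec.snd)).pair Primrec.fst)
  have hP : Primrec fun a : (List ℕ × ℕ) × ℕ => programs a.1.1 a.1.2 :=
    Primrec.list_flatMap (Primrec.list_range.comp (Primrec.nat_sub.comp
      (Primrec.list_length.comp (Primrec.fst.comp Primrec.fst)) (Primrec.snd.comp Primrec.fst)))
      (primrec_bitStrings.comp Primrec.snd)
  exact (hR.listFilter).comp hP Primrec.id

theorem primrec_survivors (c : Code) : Primrec fun a : (List ℕ × ℕ) × ℕ =>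
    survivors c a.1.1 a.1.2 a.2 := by
  have hR : PrimrecRel fun (p : BitString) (a : ((List ℕ × ℕ) × ℕ) × BitString) =>
      ((messageAt c (a.1.1.1.getD 0 0) a.1.2 p a.2).getD []).length <
        a.1.1.1.getD (p.length + a.1.1.2) 0 := by
    have hh : Primrec fun a : BitString × ((List ℕ × ℕ) × ℕ) × BitString => a.2.1.1.1 :=
      Primrec.fst.comp (Primrec.fst.comp (Primrec.fst.comp Primrec.snd))
    have hd : Primrec fun a : BitString × ((List ℕ × ℕ) × ℕ) × BitString => a.2.1.1.2 :=
      Primrec.snd.comp (Primrec.fst.comp (Primrec.fst.comp Primrec.snd))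
    refine PrimrecRel.comp Primrec.nat_lt (f := fun a : BitString × ((List ℕ × ℕ) × ℕ) × BitString =>
      ((messageAt c (a.2.1.1.1.getD 0 0) a.2.1.2 a.1 a.2.2).getD []).length)
      (g := fun a => a.2.1.1.1.getD (a.1.length + a.2.1.1.2) 0) ?_ ?_
    · exact Primrec.list_length.comp (Primrec.option_getD.comp ((primrec_messageAt c).comp
        ((((Primrec.list_getD 0).comp hh (Primrec.const 0)).pair
          (Primrec.snd.comp (Primrec.fst.comp Primrec.snd))).pair
          (Primrec.fst.pair (Primrec.snd.comp Primrec.snd)))) (Primrec.const []))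
    · exact (Primrec.list_getD 0).comp hh
        (Primrec.nat_add.comp (Primrec.list_length.comp Primrec.fst) hd)
  have hB : PrimrecRel fun (y : BitString) (a : (List ℕ × ℕ) × ℕ) =>
      ¬ IsBad c a.1.1 a.1.2 a.2 y :=
    PrimrecPred.not (hR.exists_mem_list.comp ((primrec_activePrograms c).comp Primrec.snd)
      (Primrec.snd.pair Primrec.fst))
  exact hB.listFilter.comp (primrec_bitStrings.comp ((Primrec.list_getD 0).comp
    (Primrec.fst.comp Primrec.fst) (Primrec.const 0))) Primrec.id

theorem primrec_list_sum : Primrec (List.sum : List ℕ → ℕ) :=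
  Primrec.list_foldr (h := fun _ a => a.1 + a.2) Primrec.id (Primrec.const 0)
    (Primrec.nat_add.comp (Primrec.fst.comp Primrec.snd) (Primrec.snd.comp Primrec.snd))

theorem primrec_weight (c : Code) : Primrec fun a : ((List ℕ × ℕ) × ℕ) × ℕ =>
    weight c a.1.1.1 a.1.1.2 a.1.2 a.2 := by
  have hh : Primrec fun a : (((List ℕ × ℕ) × ℕ) × ℕ) × BitString => a.1.1.1.1 :=
    Primrec.fst.comp (Primrec.fst.comp (Primrec.fst.comp Primrec.fst))
  have hl : Primrec fun a : ((List ℕ × ℕ) × ℕ) × ℕ =>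
      (activePrograms c a.1.1.1 a.1.1.2 a.2).map fun p =>
        2 ^ min (a.1.1.1.getD (p.length + a.1.1.2) 0) (a.1.1.1.getD a.1.2 0) := by
    refine Primrec.list_map ((primrec_activePrograms c).comp
      ((Primrec.fst.comp Primrec.fst).pair Primrec.snd)) ?_
    exact primrec_two_pow.comp (Primrec.nat_min.comp
      ((Primrec.list_getD 0).comp hh (Primrec.nat_add.comp (Primrec.list_length.comp Primrec.snd)
        (Primrec.snd.comp (Primrec.fst.comp (Primrec.fst.comp Primrec.fst)))))
      ((Primrec.list_getD 0).comp hh (Primrec.snd.comp (Primrec.fst.comp Primrec.fst))))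
  exact primrec_list_sum.comp hl

theorem mem_activePrograms {c : Code} {h : List ℕ} {δ t : ℕ} {p : BitString} :
    p ∈ activePrograms c h δ t ↔ p.length + δ < h.length ∧ IsActive c (h.getD 0 0) t p := by
  simp [activePrograms, mem_programs]

theorem activePrograms_mono {c : Code} {h : List ℕ} {δ t t' : ℕ} (ht : t ≤ t') {p : BitString}
    (hp : p ∈ activePrograms c h δ t) : p ∈ activePrograms c h δ t' := by
  rw [mem_activePrograms] at hp ⊢
  exact ⟨hp.1, hp.2.mono ht⟩

theorem mem_survivors {c : Code} {h : List ℕ} {δ t : ℕ} {y : BitString} :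
    y ∈ survivors c h δ t ↔ y.length = h.getD 0 0 ∧ ¬ IsBad c h δ t y := by
  simp [survivors, mem_bitStrings]

theorem messageAt_eq_of_isActive {c : Code} {n t t' : ℕ} {p y : BitString} (ht : t ≤ t')
    (hp : IsActive c n t p) (hy : y.length = n) : messageAt c n t' p y = messageAt c n t p y := by
  obtain ⟨m, hm⟩ := Option.isSome_iff_exists.1 (hp y (mem_bitStrings.2 hy))
  rw [hm, messageAt_mono ht hm]

theorem IsBad.mono {c : Code} {h : List ℕ} {δ t t' : ℕ} (ht : t ≤ t') {y : BitString}
    (hy : y.length = h.getD 0 0) (hb : IsBad c h δ t y) : IsBad c h δ t' y := by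
  obtain ⟨p, hp, hl⟩ := hb
  refine ⟨p, activePrograms_mono ht hp, ?_⟩
  rwa [messageAt_eq_of_isActive ht (mem_activePrograms.1 hp).2 hy]

theorem weight_eq_sum (c : Code) (h : List ℕ) (δ i t : ℕ) :
    weight c h δ i t = ∑ p ∈ (activePrograms c h δ t).toFinset,
      2 ^ min (h.getD (p.length + δ) 0) (h.getD i 0) := by
  rw [weight, List.sum_toFinset]
  exact (nodup_programs h δ).filter _

/-! ### Counting the strings struck out -/

/-- At each scale the total weight is small. -/
theorem weight_lt {c : Code} {h : List ℕ} {δ i : ℕ} (t : ℕ)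
    (hh : ∀ i j, i ≤ j → j < h.length → h.getD j 0 + j ≤ h.getD i 0 + i)
    (hδ : h.length < 2 ^ δ) :
    weight c h δ i t < 2 ^ i * 2 ^ h.getD i 0 := by
  have h1 : weight c h δ i t ≤ ∑ j ∈ Finset.range (h.length - δ), ∑ _p ∈ (bitStrings j).toFinset,
      2 ^ min (h.getD (j + δ) 0) (h.getD i 0) := by
    have hsub : (activePrograms c h δ t).toFinset ⊆
        (Finset.range (h.length - δ)).biUnion fun j => (bitStrings j).toFinset := by
      intro p hp
      have := (mem_activePrograms.1 (List.mem_toFinset.1 hp)).1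
      simp only [Finset.mem_biUnion, Finset.mem_range, List.mem_toFinset, mem_bitStrings]
      exact ⟨p.length, by omega, rfl⟩
    rw [weight_eq_sum]
    refine (Finset.sum_le_sum_of_subset hsub).trans ?_
    rw [Finset.sum_biUnion]
    · refine Finset.sum_le_sum fun j _ => Finset.sum_le_sum fun p hp => ?_
      rw [mem_bitStrings.1 (List.mem_toFinset.1 hp)]
    · intro a _ b _ hab
      rw [Function.onFun, Finset.disjoint_left]
      intro s hs hs'
      rw [List.mem_toFinset, mem_bitStrings] at hs hs'
      exact hab (hs.symm.trans hs')
  have h2 : weight c h δ i t * 2 ^ δ ≤ h.length * (2 ^ i * 2 ^ h.getD i 0) := by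
    refine (Nat.mul_le_mul_right _ h1).trans ?_
    rw [Finset.sum_mul]
    refine (Finset.sum_le_card_nsmul _ _ (2 ^ i * 2 ^ h.getD i 0) fun j hj => ?_).trans ?_
    · rw [Finset.mem_range] at hj
      rw [Finset.sum_const, smul_eq_mul, List.toFinset_card_of_nodup (nodup_bitStrings j),
        length_bitStrings, ← pow_add, ← pow_add, ← pow_add]
      refine Nat.pow_le_pow_right (by norm_num) ?_
      -- Programs of length `j` weigh at most `2 ^ (i + h i - δ)` together: for `j + δ ≥ i` because
      -- `h j + j` does not increase, otherwise because of the truncation at `h i`.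
      rcases le_total i (j + δ) with hij | hij
      · have := hh i (j + δ) hij (by omega)
        have := min_le_left (h.getD (j + δ) 0) (h.getD i 0)
        omega
      · have := min_le_right (h.getD (j + δ) 0) (h.getD i 0)
        omega
    · rw [Finset.card_range, smul_eq_mul]
      exact Nat.mul_le_mul_right _ (Nat.sub_le _ _)
  have h3 : h.length * (2 ^ i * 2 ^ h.getD i 0) < 2 ^ δ * (2 ^ i * 2 ^ h.getD i 0) :=
    Nat.mul_lt_mul_of_pos_right hδ (by positivity)
  have h4 := h2.trans_lt h3
  rw [mul_comm] at h4
  exact Nat.lt_of_mul_lt_mul_left h4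

/-- A family of active programs makes few strings bad. -/
theorem card_le_sum_of_short {c : Code} {h : List ℕ} {δ t : ℕ} (X S : Finset BitString)
    (hX : ∀ p ∈ X, IsActive c (h.getD 0 0) t p)
    (hS : ∀ y ∈ S, y.length = h.getD 0 0 ∧ ∃ p ∈ X,
      ((messageAt c (h.getD 0 0) t p y).getD []).length < h.getD (p.length + δ) 0) :
    S.card ≤ ∑ p ∈ X, 2 ^ h.getD (p.length + δ) 0 := by
  classical
  let B (p : BitString) : Finset BitString := S.filter fun y =>
    ((messageAt c (h.getD 0 0) t p y).getD []).length < h.getD (p.length + δ) 0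
  have hsub : S ⊆ X.biUnion B := by
    intro y hy
    obtain ⟨p, hp, hl⟩ := (hS y hy).2
    exact Finset.mem_biUnion.2 ⟨p, hp, Finset.mem_filter.2 ⟨hy, hl⟩⟩
  refine (Finset.card_le_card hsub).trans (Finset.card_biUnion_le.trans
    (Finset.sum_le_sum fun p hp => ?_))
  have hinj : Set.InjOn (fun y => (messageAt c (h.getD 0 0) t p y).getD []) (B p : Set _) := by
    intro y hy y' hy' he
    have hy := Finset.mem_filter.1 (Finset.mem_coe.1 hy)
    have hy' := Finset.mem_filter.1 (Finset.mem_coe.1 hy')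
    obtain ⟨m, hm⟩ := Option.isSome_iff_exists.1 (hX p hp y (mem_bitStrings.2 (hS y hy.1).1))
    obtain ⟨m', hm'⟩ := Option.isSome_iff_exists.1 (hX p hp y' (mem_bitStrings.2 (hS y' hy'.1).1))
    simp only [hm, hm', Option.getD_some] at he
    exact messageAt_injective hm (he ▸ hm')
  rw [← Finset.card_image_of_injOn hinj]
  refine card_le_of_length_lt _ _ fun s hs => ?_
  obtain ⟨y, hy, rfl⟩ := Finset.mem_image.1 hs
  exact (Finset.mem_filter.1 hy).2

/-- If the weight at scale `i` has reached its final value up to `2 ^ h i`, then fewer than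
`2 ^ h i` strings become bad later. -/
theorem card_survivors_sdiff_lt {c : Code} {h : List ℕ} {δ i t T : ℕ} (ht : t ≤ T)
    (hw : weight c h δ i t / 2 ^ h.getD i 0 = weight c h δ i T / 2 ^ h.getD i 0) :
    ((survivors c h δ t).toFinset \ (survivors c h δ T).toFinset).card < 2 ^ h.getD i 0 := by
  set X := (activePrograms c h δ T).toFinset \ (activePrograms c h δ t).toFinset with hX
  have hsub : (activePrograms c h δ t).toFinset ⊆ (activePrograms c h δ T).toFinset :=
    fun p hp => List.mem_toFinset.2 (activePrograms_mono ht (List.mem_toFinset.1 hp))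
  have hsum : ∑ p ∈ X, 2 ^ min (h.getD (p.length + δ) 0) (h.getD i 0) < 2 ^ h.getD i 0 := by
    have h1 := Finset.sum_sdiff (f := fun p : BitString =>
      2 ^ min (h.getD (p.length + δ) 0) (h.getD i 0)) hsub
    rw [← weight_eq_sum, ← weight_eq_sum, ← hX] at h1
    have h2 := Nat.div_add_mod (weight c h δ i t) (2 ^ h.getD i 0)
    have h3 := Nat.div_add_mod (weight c h δ i T) (2 ^ h.getD i 0)
    have h4 := Nat.mod_lt (weight c h δ i T) (y := 2 ^ h.getD i 0) (by positivity)
    rw [hw] at h2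
    omega
  -- A truncated new program would alone contribute a full unit `2 ^ h i`. Hence no new program is
  -- truncated, and the weight increase bounds the number of newly bad strings.
  have hsmall : ∀ p ∈ X, min (h.getD (p.length + δ) 0) (h.getD i 0) = h.getD (p.length + δ) 0 := by
    intro p hp
    have h1 := (Finset.single_le_sum (f := fun p : BitString =>
      2 ^ min (h.getD (p.length + δ) 0) (h.getD i 0)) (fun _ _ => Nat.zero_le _) hp).trans_lt hsum
    have h2 := (Nat.pow_lt_pow_iff_right (by norm_num : 1 < 2)).1 h1
    omega
  rw [Finset.sum_congr rfl fun p hp => by rw [hsmall p hp]] at hsum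
  refine (card_le_sum_of_short (c := c) (t := T) (δ := δ) X _ (fun p hp => ?_)
    fun y hy => ?_).trans_lt hsum
  · exact (mem_activePrograms.1 (List.mem_toFinset.1 (Finset.mem_sdiff.1 hp).1)).2
  · simp only [Finset.mem_sdiff, List.mem_toFinset, mem_survivors, not_and, not_not] at hy
    obtain ⟨⟨hy, hnb⟩, hb⟩ := hy
    obtain ⟨p, hp, hl⟩ := hb hy
    refine ⟨hy, p, ?_, hl⟩
    simp only [hX, Finset.mem_sdiff, List.mem_toFinset]
    refine ⟨hp, fun hp' => hnb ⟨p, hp', ?_⟩⟩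
    rwa [← messageAt_eq_of_isActive ht (mem_activePrograms.1 hp').2 hy]

/-- At scale `0` truncation is void, since `h 0` is the largest value; so the weight bounds the
number of bad strings, and it is below `2 ^ h 0`. -/
theorem survivors_ne_nil {c : Code} {h : List ℕ} {δ : ℕ} (t : ℕ)
    (hh : ∀ i j, i ≤ j → j < h.length → h.getD j 0 + j ≤ h.getD i 0 + i)
    (hδ : h.length < 2 ^ δ) : survivors c h δ t ≠ [] := by
  intro hnil
  have hw := weight_lt (c := c) (i := 0) t hh hδ
  rw [weight_eq_sum, pow_zero, one_mul] at hw
  have h1 := card_le_sum_of_short (c := c) (h := h) (δ := δ) (t := t)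
    (activePrograms c h δ t).toFinset (bitStrings (h.getD 0 0)).toFinset
    (fun p hp => (mem_activePrograms.1 (List.mem_toFinset.1 hp)).2) fun y hy => by
      have hy := mem_bitStrings.1 (List.mem_toFinset.1 hy)
      have hb : y ∉ survivors c h δ t := by simp [hnil]
      rw [mem_survivors, not_and, not_not] at hb
      obtain ⟨p, hp, hl⟩ := hb hy
      exact ⟨hy, p, List.mem_toFinset.2 hp, hl⟩
  rw [List.toFinset_card_of_nodup (nodup_bitStrings _), length_bitStrings] at h1
  refine absurd (h1.trans (Finset.sum_le_sum fun p hp => ?_)) (not_le.2 hw)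
  have hp := (mem_activePrograms.1 (List.mem_toFinset.1 hp)).1
  have := hh 0 (p.length + δ) (Nat.zero_le _) hp
  exact Nat.pow_le_pow_right (by norm_num) (by omega)

/-- Only finitely many programs compete and none is ever deactivated. The time is not computable;
descriptions will refer to it only through the final level of the weight. -/
theorem exists_stable_time (c : Code) (h : List ℕ) (δ : ℕ) :
    ∃ T, ∀ t, ∀ p ∈ activePrograms c h δ t, p ∈ activePrograms c h δ T := by
  have : ∀ᶠ T in Filter.atTop, ∀ p ∈ (programs h δ).toFinset,
      ∀ t, p ∈ activePrograms c h δ t → p ∈ activePrograms c h δ T := by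
    rw [Filter.eventually_all_finset]
    intro p _
    by_cases hp : ∃ t, p ∈ activePrograms c h δ t
    · obtain ⟨t, ht⟩ := hp
      filter_upwards [Filter.eventually_ge_atTop t] with T hT _ _ using activePrograms_mono hT ht
    · push Not at hp
      exact Filter.Eventually.of_forall fun T t ht => absurd ht (hp t)
  obtain ⟨T, hT⟩ := this.exists
  exact ⟨T, fun t p hp => hT p (List.mem_toFinset.2 (List.mem_filter.1 hp).1) t hp⟩

/-- The first survivor at a later time has a small rank among the earlier survivors. -/
theorem idxOf_headI_le {l : List BitString} (hl : l.Nodup) {P Q : BitString → Prop}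
    [DecidablePred P] [DecidablePred Q] (hQP : ∀ y ∈ l, Q y → P y)
    (hne : l.filter (Q ·) ≠ []) :
    (l.filter (P ·)).idxOf (l.filter (Q ·)).headI ≤
      ((l.filter (P ·)).toFinset \ (l.filter (Q ·)).toFinset).card := by
  obtain ⟨y, r, hr⟩ := List.exists_cons_of_ne_nil hne
  obtain ⟨as, bs, rfl, has, hy, -⟩ := List.filter_eq_cons_iff.1 hr
  have hny : y ∉ as.filter (P ·) := fun h => has y (List.mem_filter.1 h).1 hy
  have hPy : P y := hQP y (by simp) (by simpa using hy)
  rw [hr, List.headI_cons, List.filter_append, List.idxOf_append_of_notMem hny,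
    List.filter_cons_of_pos (by simpa using hPy), List.idxOf_cons_self, add_zero,
    ← List.toFinset_card_of_nodup ((hl.sublist (List.sublist_append_left _ _)).filter _)]
  refine Finset.card_le_card fun z hz => ?_
  rw [List.mem_toFinset] at hz
  rw [Finset.mem_sdiff, ← hr]
  refine ⟨List.mem_toFinset.2 (List.mem_append_left _ hz), fun h => ?_⟩
  exact has z (List.mem_filter.1 hz).1 (List.mem_filter.1 (List.mem_toFinset.1 h)).2

/-- Every survivor at time `t` listed before the first survivor at time `T` is struck out in
between. -/
theorem idxOf_survivors_lt {c : Code} {h : List ℕ} {δ i t T : ℕ} (ht : t ≤ T)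
    (hne : survivors c h δ T ≠ [])
    (hw : weight c h δ i t / 2 ^ h.getD i 0 = weight c h δ i T / 2 ^ h.getD i 0) :
    (survivors c h δ t).idxOf (survivors c h δ T).headI < 2 ^ h.getD i 0 :=
  (idxOf_headI_le (nodup_bitStrings _) (fun _ hy hT hb =>
    hT (hb.mono ht (mem_bitStrings.1 hy))) hne).trans_lt (card_survivors_sdiff_lt ht hw)

/-! ### The lower bound for survivors -/

theorem exists_messageAt {c : Code} {n : ℕ} {p y m : BitString} {P : OneWayProtocol}
    (hP : encode (P.alice, P.bob) ∈ c.eval (encode (p, n))) (hm : P.Sends y m)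
    (hy : P.Outputs (bitStrings n).headI m y) : ∃ t, messageAt c n t p y = some m := by
  obtain ⟨t₁, h₁⟩ := Code.evaln_complete.1 hP
  obtain ⟨t₂, h₂⟩ := Code.evaln_complete.1 hm
  obtain ⟨t₃, h₃⟩ := Code.evaln_complete.1 hy
  refine ⟨max t₁ (max t₂ t₃), messageAt_eq_some.2 ⟨(P.alice, P.bob), ?_, ?_, ?_⟩⟩
  · exact Code.evaln_mono (by simp) h₁
  · exact Code.evaln_mono (by simp) h₂
  · exact Code.evaln_mono (by simp) h₃

theorem messageAt_sends {c : Code} {n t : ℕ} {p y m : BitString} {P : OneWayProtocol}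
    (hP : encode (P.alice, P.bob) ∈ c.eval (encode (p, n)))
    (hm : messageAt c n t p y = some m) : P.Sends y m := by
  obtain ⟨Q, h1, h2, -⟩ := messageAt_eq_some.1 hm
  have hQ : Q = (P.alice, P.bob) :=
    encode_injective (Part.mem_unique (Code.evaln_sound h1) hP)
  subst hQ
  exact Code.evaln_sound h2

theorem exists_isActive {c : Code} {n : ℕ} {p : BitString} {P : OneWayProtocol}
    (hP : encode (P.alice, P.bob) ∈ c.eval (encode (p, n)))
    (htot : P.TotallyComputes n identityFn) : ∃ t, IsActive c n t p := by
  have : ∀ᶠ t in Filter.atTop, ∀ y ∈ (bitStrings n).toFinset, (messageAt c n t p y).isSome := by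
    rw [Filter.eventually_all_finset]
    intro y hy
    obtain ⟨m, hm, ho⟩ := htot (bitStrings n).headI y (length_headI_bitStrings n)
      (mem_bitStrings.1 (List.mem_toFinset.1 hy))
    obtain ⟨t, ht⟩ := exists_messageAt hP hm ho
    filter_upwards [Filter.eventually_ge_atTop t] with t' ht'
    simp [messageAt_mono ht' ht]
  obtain ⟨t, ht⟩ := this.exists
  exact ⟨t, fun y hy => ht y (List.mem_toFinset.2 hy)⟩

/-- A string that survives for good gets long messages from simple protocols. -/
theorem le_TCC_of_mem_survivors {U : DescriptionMode} {c : Code}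
    (hc : ∀ p z, c.eval (encode (p, z)) = U p z) {h : List ℕ} {δ T α : ℕ} {y : BitString}
    (hh : ∀ i j, i ≤ j → j < h.length → h.getD j 0 + j ≤ h.getD i 0 + i)
    (hT : ∀ t, ∀ p ∈ activePrograms c h δ t, p ∈ activePrograms c h δ T)
    (hy : y ∈ survivors c h δ T) (hα : α + δ < h.length) :
    (h.getD (α + δ) 0 : ℕ∞) ≤ TCC U identityFn α y := by
  obtain ⟨hyn, hgood⟩ := mem_survivors.1 hy
  refine le_iInf fun P => le_iInf fun m => le_iInf fun htot => le_iInf fun hα' =>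
    le_iInf fun hm => ?_
  rw [hyn] at htot hα'
  obtain ⟨p, hpα, hp⟩ := exists_program_of_condC_le hα'
  rw [encode_nat, ← hc] at hp
  obtain ⟨t, ht⟩ := exists_isActive hp htot
  have hact := hT t p (mem_activePrograms.2 ⟨by omega, ht⟩)
  obtain ⟨m', hm'⟩ := Option.isSome_iff_exists.1
    ((mem_activePrograms.1 hact).2 y (mem_bitStrings.2 hyn))
  have hmm : m' = m := encode_injective (Part.mem_unique (messageAt_sends hp hm') hm)
  subst hmm
  have h1 : h.getD (p.length + δ) 0 ≤ m'.length := by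
    by_contra hlt
    exact hgood ⟨p, hact, by rw [hm']; exact not_le.1 hlt⟩
  have h2 := hh (p.length + δ) (α + δ) (by omega) hα
  exact_mod_cast (by omega : h.getD (α + δ) 0 ≤ m'.length)

theorem TCC_le {U : DescriptionMode} {f : BitString → BitString → BitString} {α : ℕ}
    {y m : BitString} {P : OneWayProtocol} (htot : P.TotallyComputes y.length f)
    (hα : P.complexity U y.length ≤ α) (hm : P.Sends y m) : TCC U f α y ≤ m.length :=
  iInf_le_of_le P <| iInf_le_of_le m <| iInf_le_of_le htot <| iInf_le_of_le hα <| iInf_le _ hm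

/-! ### Short descriptions of lists of survivors -/

/-- The survivors at the first time when the weight at scale `i` reaches the level `q`; the two
strings denote `i` and `q`, and the length of the first one is the parameter `δ`. -/
def survivorsAtLevel (c : Code) (h : List ℕ) (s : BitString × BitString) : Part (List BitString) :=
  (Nat.rfind fun t => Part.some (decide (weight c h s.1.length (stringRank s.1) t /
    2 ^ h.getD (stringRank s.1) 0 = stringRank s.2))).map fun t => survivors c h s.1.length t

theorem partrec_survivorsAtLevel (c : Code) : Partrec₂ (survivorsAtLevel c) := by
  have hr : Primrec fun a : (List ℕ × BitString × BitString) × ℕ => stringRank a.1.2.1 :=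
    primrec_stringRank.comp (Primrec.fst.comp (Primrec.snd.comp Primrec.fst))
  have hl : Primrec fun a : (List ℕ × BitString × BitString) × ℕ => a.1.2.1.length :=
    Primrec.list_length.comp (Primrec.fst.comp (Primrec.snd.comp Primrec.fst))
  have hh : Primrec fun a : (List ℕ × BitString × BitString) × ℕ => a.1.1 :=
    Primrec.fst.comp Primrec.fst
  have hp : PrimrecPred fun a : (List ℕ × BitString × BitString) × ℕ =>
      weight c a.1.1 a.1.2.1.length (stringRank a.1.2.1) a.2 /
        2 ^ a.1.1.getD (stringRank a.1.2.1) 0 = stringRank a.1.2.2 :=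
    Primrec.eq.comp
      (Primrec.nat_div.comp
        ((primrec_weight c).comp (((hh.pair hl).pair hr).pair Primrec.snd))
        (primrec_two_pow.comp ((Primrec.list_getD 0).comp hh hr)))
      (primrec_stringRank.comp (Primrec.snd.comp (Primrec.snd.comp Primrec.fst)))
  have hp' := hp.decide.to_comp.to₂.partrec₂
  exact (Partrec.rfind hp').map
    ((primrec_survivors c).comp ((hh.pair hl).pair Primrec.snd)).to_comp.to₂

/-- Decodes a program that consists of a description of a table `h`, a scale `i` and a level. The
result is `h i` with the list of survivors. -/
def stageOf (U : DescriptionMode) (c : Code) (p : BitString) : Part (ℕ × List BitString) :=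
  (U (splitBlock p).1 0).bind fun e => (decode₂ (List ℕ) e : Part (List ℕ)).bind fun h =>
    (survivorsAtLevel c h (splitBlock (splitBlock p).2)).map fun N =>
      (h.getD (stringRank (splitBlock (splitBlock p).2).1) 0, N)

theorem partrec_stageOf {U : DescriptionMode} (hU : Partrec₂ U) (c : Code) :
    Partrec (stageOf U c) := by
  have hs : Primrec fun a : (BitString × ℕ) × List ℕ => splitBlock (splitBlock a.1.1).2 :=
    primrec_splitBlock.comp (Primrec.snd.comp (primrec_splitBlock.comp
      (Primrec.fst.comp Primrec.fst)))
  refine (hU.comp (Primrec.fst.comp primrec_splitBlock).to_comp (Computable.const 0)).bind ?_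
  refine ((Primrec.decode₂.comp Primrec.snd).to_comp.ofOption).bind ?_
  refine ((partrec_survivorsAtLevel c).comp Computable.snd hs.to_comp).map ?_
  exact (((Primrec.list_getD 0).comp (Primrec.snd.comp Primrec.fst) (primrec_stringRank.comp
    (Primrec.fst.comp (hs.comp Primrec.fst)))).pair Primrec.snd).to_comp.to₂

/-- A program for the survivors at a time when the weight at scale `i` has its final value. -/
theorem exists_program_stageOf {U : DescriptionMode} {c : Code} {h : List ℕ} {δ i T : ℕ}
    {r : BitString} (hr : encode h ∈ U r 0)
    (hh : ∀ i j, i ≤ j → j < h.length → h.getD j 0 + j ≤ h.getD i 0 + i)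
    (hδ : h.length < 2 ^ δ) (hi : i < h.length) :
    ∃ p : BitString, p.length = 2 * r.length + 2 * δ + 2 + i ∧ ∃ t ≤ T,
      weight c h δ i t / 2 ^ h.getD i 0 = weight c h δ i T / 2 ^ h.getD i 0 ∧
      (h.getD i 0, survivors c h δ t) ∈ stageOf U c p := by
  obtain ⟨s, rfl, hsi⟩ := exists_stringRank_eq (hi.trans hδ)
  obtain ⟨q, rfl, hqr⟩ := exists_stringRank_eq
    ((Nat.div_lt_iff_lt_mul (by positivity)).2 (weight_lt (c := c) (i := i) T hh hδ))
  -- The level `q` comes last and needs no delimiter, so its `i` bits are paid once; only `r` and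
  -- `s`, of logarithmic length in the application, are doubled.
  refine ⟨block r ++ (block s ++ q), ?_, ?_⟩
  · simp only [List.length_append, length_block]; omega
  · obtain ⟨t, ht, htT⟩ := Nat.rfind_min' (p := fun t => decide (weight c h s.length q.length t /
      2 ^ h.getD q.length 0 = stringRank q)) (m := T) (by simp [hqr])
    refine ⟨t, htT, ?_, ?_⟩
    · rw [← hqr]; exact of_decide_eq_true (Part.mem_some_iff.1 (Nat.rfind_spec ht)).symm
    · simp only [stageOf, splitBlock_block_append, Part.mem_bind_iff]
      refine ⟨_, hr, h, by simp, ?_⟩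
      rw [hsi, Part.mem_map_iff]
      refine ⟨_, ?_, rfl⟩
      rw [survivorsAtLevel, hsi]
      exact Part.mem_map _ ht

/-- Alice tells a code word from a string sent verbatim by its length. -/
theorem totallyComputes_of_recode {P : OneWayProtocol} {A B : List BitString} {n : ℕ}
    (hP : ∀ x y, P.Sends y (recode A B y) ∧ P.Outputs x y (recode B A y))
    (hl : A.length = B.length) (hB : B.Nodup) (hn : ∀ y ∈ B, y.length ≠ n) :
    P.TotallyComputes n identityFn := by
  intro x y _ hy
  refine ⟨_, (hP x y).1, ?_⟩
  have := (hP x (recode A B y)).2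
  rwa [recode_recode hl hB fun h => absurd hy (hn y h)] at this

/-! ### Assembly of the theorem -/

theorem lt_two_pow_logLen (n : ℕ) : n < 2 ^ logLen n := Nat.lt_pow_succ_log_self (by norm_num) n

theorem length_valueTable (h : ℕ → ℕ) (k : ℕ) : (valueTable h k).length = k + 1 := by
  simp [valueTable]

theorem getD_valueTable {h : ℕ → ℕ} {k j : ℕ} (hj : j ≤ k) : (valueTable h k).getD j 0 = h j := by
  have : j < k + 1 := by omega
  simp [valueTable, this]

theorem add_le_add_of_strictAntiOn {h : ℕ → ℕ} {k i j : ℕ} (hh : StrictAntiOn h (Set.Icc 0 k))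
    (hij : i ≤ j) (hj : j ≤ k) : h j + j ≤ h i + i := by
  induction j, hij using Nat.le_induction with
  | base => rfl
  | succ j hij ih =>
    have := hh (Set.mem_Icc.2 ⟨Nat.zero_le j, by omega⟩) (Set.mem_Icc.2 ⟨Nat.zero_le _, hj⟩)
      (Nat.lt_succ_self j)
    have := ih (by omega)
    omega

/-- Optimality for a description mode that ignores its condition. -/
theorem IsOptimalMachine.exists_const {U : DescriptionMode} (hU : IsOptimalMachine U) {σ : Type}
    [Primcodable σ] {f : BitString →. σ} (hf : Partrec f) :
    ∃ e : ℕ, ∀ (p : BitString) (a : σ), a ∈ f p → ∀ {B : Type} [Primcodable B] (b : B),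
      condC U a b ≤ ((p.length + e : ℕ) : ℕ∞) := by
  obtain ⟨e, he⟩ := hU.optimal (fun p _ => (f p).map encode)
    ((Partrec.map_encode_iff.2 hf).comp Computable.fst)
  refine ⟨e, fun p a ha B _ b => ?_⟩
  obtain ⟨q, hq, hqa⟩ := he p (encode b) (encode a) (Part.mem_map _ ha)
  exact (condC_le_of_mem hqa).trans (by exact_mod_cast hq)

theorem mainTheorem2 (U : DescriptionMode) (hU : IsOptimalMachine U) (c : ℕ) :
    ∃ d : ℕ, ∀ (n k : ℕ) (h : ℕ → ℕ), k ≤ n →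
      StrictAntiOn h (Set.Icc 0 k) → h 0 = n → h k = 0 →
      plainC U (valueTable h k) ≤ ((c * logLen n : ℕ) : ℕ∞) →
      (∀ α ≤ k, k ≤ h α + α) →
      ∃ y : BitString, y.length = n ∧
        plainC U y ≤ ((k + d * logLen n : ℕ) : ℕ∞) ∧
        (k : ℕ∞) ≤ plainC U y + ((d * logLen n : ℕ) : ℕ∞) ∧
        (∀ α ≤ k, TCC U identityFn (α + d * logLen n) y ≤ (h α : ℕ∞)) ∧
        (∀ α : ℕ, α + d * logLen n ≤ k →
          (h (α + d * logLen n) : ℕ∞) ≤ TCC U identityFn α y) := by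
  obtain ⟨u, hu⟩ := hU.partrec.exists_code
  obtain ⟨F, hF, hFspec⟩ := exists_tableProtocol
  obtain ⟨e₀, he₀⟩ := hU.exists_const (Partrec.some.comp (Computable.const (F [] [])))
  have htab : Primrec fun a : ℕ × List BitString =>
      F (a.2.take (2 ^ a.1)) ((bitStrings a.1).take a.2.length) :=
    hF.comp (Primrec.list_take.comp (primrec_two_pow.comp Primrec.fst) Primrec.snd)
      (Primrec.list_take.comp (Primrec.list_length.comp Primrec.snd)
        (primrec_bitStrings.comp Primrec.fst))
  obtain ⟨e₁, he₁⟩ := hU.exists_const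
    ((partrec_stageOf hU.partrec u).map (htab.comp Primrec.snd).to_comp.to₂)
  obtain ⟨e₂, he₂⟩ := hU.exists_const ((partrec_stageOf hU.partrec u).map
    (Primrec.list_headI.comp (Primrec.snd.comp Primrec.snd)).to_comp.to₂)
  obtain ⟨e₃, he₃⟩ := hU.exists_const (((hU.partrec.comp Computable.id (Computable.const 0)).bind
    ((Primrec.decode₂ (α := BitString)).comp Primrec.snd).to_comp.ofOption.to₂).map
    (hF.comp (Primrec.list_cons.comp Primrec.snd (Primrec.const []))
      (Primrec.const [[]])).to_comp.to₂)
  refine ⟨2 * c + 6 + e₀ + e₁ + e₂ + e₃, fun n k h hkn hanti h0 hk hC _ => ?_⟩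
  set L := logLen n with hL
  set d := 2 * c + 6 + e₀ + e₁ + e₂ + e₃ with hd
  have hL1 : 1 ≤ L := Nat.succ_pos _
  -- The terms are the self-delimited description of `h`, the block of length `2 * δ + 1` with `δ =
  -- 2 * L`, the two delimiters, and the machine constants, absorbed because `L ≥ 1`.
  have hdL : 2 * (c * L) + 4 * L + 2 + e₀ + e₁ + e₂ + e₃ ≤ d * L := by
    rw [hd]; nlinarith
  -- The factor 2 makes `2 ^ δ` exceed `k + 1`, as `k + 1 ≤ 2 ^ L < 2 ^ δ`.
  set δ := 2 * L with hδ
  set H := valueTable h k with hH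
  have hlen : H.length = k + 1 := length_valueTable h k
  have hget {j : ℕ} (hj : j ≤ k) : H.getD j 0 = h j := getD_valueTable hj
  have hmono : ∀ i j, i ≤ j → j < H.length → H.getD j 0 + j ≤ H.getD i 0 + i := by
    intro i j hij hj
    rw [hget (by omega), hget (by omega)]
    exact add_le_add_of_strictAntiOn hanti hij (by omega)
  have hn0 : H.getD 0 0 = n := by rw [hget (Nat.zero_le k), h0]
  have hlenδ : H.length < 2 ^ δ := by
    have h1 : n < 2 ^ L := lt_two_pow_logLen n
    have h2 : 2 ^ L < 2 ^ δ := Nat.pow_lt_pow_right (by norm_num) (by omega)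
    omega
  obtain ⟨T, hT⟩ := exists_stable_time u H δ
  have hne : survivors u H δ T ≠ [] := survivors_ne_nil T hmono hlenδ
  set y := (survivors u H δ T).headI with hy
  have hyT : y ∈ survivors u H δ T := by
    obtain ⟨a, l, hal⟩ := List.exists_cons_of_ne_nil hne
    rw [hy, hal]; simp
  have hyn : y.length = n := (mem_survivors.1 hyT).1.trans hn0
  have hlow : ∀ α, α + δ ≤ k → (h (α + δ) : ℕ∞) ≤ TCC U identityFn α y := by
    intro α hα
    rw [← hget hα]
    exact le_TCC_of_mem_survivors hu hmono hT hyT (by omega)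
  obtain ⟨r, hrl, hr⟩ := exists_program_of_condC_le hC
  have hstage : ∀ i ≤ k, ∃ p : BitString, p.length ≤ 2 * (c * L) + 4 * L + 2 + i ∧
      ∃ N : List BitString, (h i, N) ∈ stageOf U u p ∧ y ∈ N ∧ N.idxOf y < 2 ^ h i := by
    intro i hi
    obtain ⟨p, hp, t, htT, hw, hmem⟩ := exists_program_stageOf (c := u) (T := T) (δ := δ)
      hr hmono hlenδ (i := i) (by omega)
    have hidx := idxOf_survivors_lt htT hne hw
    rw [hget hi] at hmem hidx
    refine ⟨p, by omega, _, hmem, ?_, hidx⟩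
    obtain ⟨h1, h2⟩ := mem_survivors.1 hyT
    exact mem_survivors.2 ⟨h1, fun hb => h2 (hb.mono htT h1)⟩
  refine ⟨y, hyn, ?_, ?_, ?_, ?_⟩
  · obtain ⟨p, hp, N, hN, hyN, hidx⟩ := hstage k le_rfl
    have hNy : N.headI = y := by
      -- Since `2 ^ h k = 1`, the place of `y` in the list is `0`.
      rw [hk, pow_zero, Nat.lt_one_iff] at hidx
      cases N with
      | nil => simp at hyN
      | cons a l =>
        by_contra hne
        rw [List.idxOf_cons_ne l (show a ≠ y from hne)] at hidx
        omega
    have := he₂ p y (hNy ▸ Part.mem_map _ hN) ()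
    exact this.trans (by exact_mod_cast (by omega))
  · by_contra! hlt
    obtain ⟨m, hm⟩ := ENat.ne_top_iff_exists.1 (fun htop => by simp [htop] at hlt :
      plainC U y ≠ ⊤)
    rw [← hm] at hlt
    have hlt : m + d * L < k := by exact_mod_cast hlt
    obtain ⟨q, hq, hqy⟩ := exists_program_of_condC_le (show condC U y () ≤ (m : ℕ∞) from hm.symm.le)
    have hcomp := he₃ q (F [y] [[]]) (by
      simp only [Part.mem_map_iff, Part.mem_bind_iff]
      exact ⟨y, ⟨_, hqy, by simp⟩, rfl⟩) n
    -- The one-entry table encodes `y` by the empty message, which is no string of length `n`,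
    -- because `n ≥ k > 0` here.
    have hspec := hFspec [y] [[]]
    have hle := TCC_le (U := U) (α := m + e₃) (P := ⟨(F [y] [[]]).1, (F [y] [[]]).2⟩)
      (totallyComputes_of_recode (n := y.length) hspec rfl (by simp)
        (by simp only [List.mem_singleton]; rintro _ rfl; simp only [List.length_nil]; omega))
      (by rw [hyn]; exact hcomp.trans (by exact_mod_cast (by omega))) (hspec y y).1
    have h1 := (hlow (m + e₃) (by omega)).trans hle
    have h2 : recode [y] [[]] y = [] := by simp [recode]
    have h3 : h k < h (m + e₃ + δ) :=
      hanti (Set.mem_Icc.2 ⟨Nat.zero_le _, by omega⟩) (Set.mem_Icc.2 ⟨Nat.zero_le _, le_rfl⟩)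
        (by omega)
    rw [h2] at h1
    have h4 : h (m + e₃ + δ) ≤ 0 := by exact_mod_cast h1
    omega
  · intro α hα
    -- At `α = 0` code words would have length `h 0 = n`, like verbatim strings; the empty table,
    -- which sends everything verbatim, serves instead.
    rcases Nat.eq_zero_or_pos α with rfl | hpos
    · have hcomp := he₀ [] (F [] []) (Part.mem_some _) n
      have hspec := hFspec [] []
      have hle := TCC_le (U := U) (α := 0 + d * L) (P := ⟨(F [] []).1, (F [] []).2⟩)
        (totallyComputes_of_recode (n := y.length) hspec rfl (by simp) (by simp))
        (by rw [hyn]; exact hcomp.trans (by exact_mod_cast (by simp; omega))) (hspec y y).1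
      rwa [show recode [] [] y = y by simp [recode], hyn, ← h0] at hle
    · obtain ⟨p, hp, N, hN, hyN, hidx⟩ := hstage α hα
      have hαn : h α < n := h0 ▸ hanti (Set.mem_Icc.2 ⟨le_rfl, Nat.zero_le k⟩)
        (Set.mem_Icc.2 ⟨Nat.zero_le _, hα⟩) hpos
      -- Both tables are cut to the smaller of `N.length` and `2 ^ h α`, so that they match entry by
      -- entry.
      set A := N.take (2 ^ h α) with hA
      set B := (bitStrings (h α)).take N.length with hB
      have hBl : ∀ z ∈ B, z.length = h α := fun z hz => mem_bitStrings.1 (List.mem_of_mem_take hz)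
      have hAB : A.length = B.length := by
        simp [hA, hB, length_bitStrings, min_comm]
      have hyA : y ∈ A := by
        rw [hA, List.mem_take_iff_getElem]
        have := List.idxOf_lt_length_of_mem hyN
        exact ⟨N.idxOf y, by omega, by simp⟩
      have hcomp := he₁ p (F A B) (Part.mem_map _ hN) n
      have hspec := hFspec A B
      have hle := TCC_le (U := U) (α := α + d * L) (P := ⟨(F A B).1, (F A B).2⟩)
        (totallyComputes_of_recode (n := y.length) hspec hAB
          ((nodup_bitStrings _).sublist (List.take_sublist _ _))
          (fun z hz => by rw [hBl z hz, hyn]; omega))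
        (by rw [hyn]; exact hcomp.trans (by exact_mod_cast (by omega))) (hspec y y).1
      have hmem : recode A B y ∈ B := by
        have : A.idxOf y < B.length := hAB ▸ List.idxOf_lt_length_of_mem hyA
        simp [recode, this]
      rwa [hBl _ hmem] at hle
  · intro α hα
    refine le_trans ?_ (hlow α (by omega))
    exact_mod_cast hanti.antitoneOn (Set.mem_Icc.2 ⟨Nat.zero_le _, by omega⟩)
      (Set.mem_Icc.2 ⟨Nat.zero_le _, hα⟩) (by omega)
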